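/- Let $A\in\mathbb{C}^{q\times n}$, let $0\neq W\in\mathbb{C}^{n\times q}$, let $m\ge 1$ be an integer, and put $k=\max\{\mathrm{Ind}(AW),\mathrm{Ind}(WA)\}$, where $\mathrm{Ind}(B)$ is the least $j\ge 0$ with $\mathrm{rank}(B^j)=\mathrm{rank}(B^{j+1})$ (and $B^0=I$). Notation. $\mathcal{R}(B)$ is the range space of $B$; $P_{\mathcal T}$ is the orthogonal projector onto a subspace $\mathcal T$; $B^\dagger$ is the Moore–Penrose inverse of $B$. For $B,C\in\mathbb{C}^{q\times n}$ write $B\star C=BWC$, and for $l\ge 1$ let $B^{\star l}=B\star\cdots\star B$ ($l$ factors); by convention $B^{\star 0}W=I_q$ and $WB^{\star 0}=I_n$. For $B\in\mathbb{C}^{q\times n}$ and $\kappa=\max\{\mathrm{Ind}(BW),\mathrm{Ind}(WB)\}$: - the $W$-weighted Drazin inverse $B^{D,W}$ is the unique $X\in\mathbb{C}^{q\times n}$ with $(BW)^{\kappa}=(BW)^{\kappa+1}XW$, $X=XWBWX$, $BWX=XWB$; if $\kappa\le 1$ it is called the $W$-weighted group inverse of $B$ and is denoted by $B^{\#,W}$;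 - the weighted core-EP inverse $B^{\textcircled{\dagger},W}$ is the unique $X\in\mathbb{C}^{q\times n}$ with $WBWX=P_{\mathcal{R}((WB)^{\kappa})}$ and $\mathcal{R}(X)\subseteq\mathcal{R}((BW)^{\kappa})$; - the $W$-weighted weak group inverse $B^{\textcircled{w},W}$ is the unique $X\in\mathbb{C}^{q\times n}$ with $BWX^{\star 2}=X$ and $BWX=B^{\textcircled{\dagger},W}WB$; - the $W$-weighted $m$-weak group inverse is $B^{\textcircled{w}_m,W}=(B^{\textcircled{\dagger},W})^{\star(m+1)}WB^{\star m}$. For a square matrix $C\in\mathbb{C}^{n\times n}$, the $m$-weak group inverse is $C^{\textcircled{w}_m}=C^{\textcircled{w}_m,I_n}$. Then: 1. $A^{\textcircled{w}_m,W}=(A^{D,W})^{\star(m+1)}P_{\mathcal{R}((WA)^k)}WA^{\star m}$; 2. $A^{\textcircled{w}_m,W}=A^{\star l}W\,(WA^{\star(l+m+1)}W)^{\dagger}\,WA^{\star m}$ for every integer $l\ge k$; 3. $A^{\textcircled{w}_m,W}=(WA^{\star(m+1)}W P_{\mathcal{R}((AW)^k)})^{\dagger}\,WA^{\star m}$; 4.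 $A^{\textcircled{w}_m,W}=A^{\star(m-1)}W\,(A^{\star m})^{\textcircled{w},W}$; 5. $A^{\textcircled{w}_m,W}=(A^{\textcircled{w},W})^{\star m}\,WA^{\star(m-1)}$; 6. the matrix $G=(AW)^mA^{\textcircled{\dagger},W}WA$ satisfies $\max\{\mathrm{Ind}(GW),\mathrm{Ind}(WG)\}\le 1$, so that $G^{\#,W}$ exists, and $A^{\textcircled{w}_m,W}=G^{\#,W}\,WA^{\star(m-1)}$; 7. $A^{\textcircled{w}_m,W}=A\left((WA)^{\textcircled{w}_m}\right)^2$. -/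

import Mathlib

noncomputable section

open scoped ComplexOrder

namespace Matrix

/-! ### Moore-Penrose inverse -/

/-- `X` satisfies the four Penrose equations for `A`. -/
structure IsMoorePenrose {q n : Type*} [Fintype q] [Fintype n]
    (A : Matrix q n ℂ) (X : Matrix n q ℂ) : Prop where
  mul_mul_self : A * X * A = A
  self_mul_mul : X * A * X = X
  conjTranspose_left : (A * X)ᴴ = A * X
  conjTranspose_right : (X * A)ᴴ = X * A

theorem existsUnique_isMoorePenrose {q n : Type*} [Fintype q] [Fintype n]
    (A : Matrix q n ℂ) : ∃! X : Matrix n q ℂ, IsMoorePenrose A X := by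
  classical
  obtain ⟨G, hG, hHGH, hGHG, hcomm⟩ : ∃ G : Matrix n n ℂ, Gᴴ = G ∧
      (Aᴴ * A) * G * (Aᴴ * A) = Aᴴ * A ∧ G * (Aᴴ * A) * G = G ∧
      (Aᴴ * A) * G = G * (Aᴴ * A) := by
    have hH : (Aᴴ * A).IsHermitian := isHermitian_conjTranspose_mul_self A
    set U : Matrix n n ℂ := (hH.eigenvectorUnitary : Matrix n n ℂ) with hU
    have hUU : Uᴴ * U = 1 := Unitary.coe_star_mul_self hH.eigenvectorUnitary
    set D : Matrix n n ℂ := diagonal (fun i => (hH.eigenvalues i : ℂ)) with hD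
    set E : Matrix n n ℂ := diagonal (fun i => ((hH.eigenvalues i)⁻¹ : ℂ)) with hE
    have hs : Aᴴ * A = U * D * Uᴴ := by
      have := hH.spectral_theorem
      rw [Unitary.conjStarAlgAut_apply] at this
      exact this
    have key : ∀ X Y : Matrix n n ℂ, (U * X * Uᴴ) * (U * Y * Uᴴ) = U * (X * Y) * Uᴴ := by
      intro X Y
      calc (U * X * Uᴴ) * (U * Y * Uᴴ) = U * X * (Uᴴ * U) * Y * Uᴴ := by
            simp only [Matrix.mul_assoc]
        _ = _ := by rw [hUU]; simp only [Matrix.mul_assoc, Matrix.one_mul]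
    have hE' : Eᴴ = E := by
      rw [hE, diagonal_conjTranspose]
      congr 1
      ext i
      simp
    refine ⟨U * E * Uᴴ, ?_, ?_, ?_, ?_⟩
    · simp only [conjTranspose_mul, conjTranspose_conjTranspose, hE', Matrix.mul_assoc]
    · rw [hs, key, key]
      congr 2
      rw [hD, hE, diagonal_mul_diagonal, diagonal_mul_diagonal]
      congr 1
      ext i
      exact mul_inv_mul_cancel _
    · rw [hs, key, key]
      congr 2
      rw [hD, hE, diagonal_mul_diagonal, diagonal_mul_diagonal]
      congr 1
      ext i
      simpa using mul_inv_mul_cancel ((hH.eigenvalues i : ℂ)⁻¹)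
    · rw [hs, key, key, hD, hE, diagonal_mul_diagonal, diagonal_mul_diagonal]
      congr 2
      simp only [mul_comm]
  obtain ⟨X, hX⟩ : ∃ X, IsMoorePenrose A X := by
    refine ⟨G * Aᴴ, ⟨?_, ?_, ?_, ?_⟩⟩
    · have h : Aᴴ * A * (G * (Aᴴ * A) - 1) = 0 := by
        rw [Matrix.mul_sub, Matrix.mul_one, ← Matrix.mul_assoc, hHGH, sub_self]
      rw [conjTranspose_mul_self_mul_eq_zero, Matrix.mul_sub, Matrix.mul_one, sub_eq_zero] at h
      simpa only [Matrix.mul_assoc] using h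
    · calc G * Aᴴ * A * (G * Aᴴ) = (G * (Aᴴ * A) * G) * Aᴴ := by simp only [Matrix.mul_assoc]
        _ = G * Aᴴ := by rw [hGHG]
    · simp only [conjTranspose_mul, conjTranspose_conjTranspose, hG, Matrix.mul_assoc]
    · rw [Matrix.mul_assoc, ← hcomm]
      simp only [conjTranspose_mul, conjTranspose_conjTranspose, hG, hcomm]
  refine ⟨X, hX, fun Y hY => ?_⟩
  have h1 : A * X = A * Y := by
    calc A * X = (A * Y) * (A * X) := by rw [← Matrix.mul_assoc, hY.mul_mul_self]
      _ = (A * Y)ᴴ * (A * X)ᴴ := by rw [hY.conjTranspose_left, hX.conjTranspose_left]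
      _ = (A * X * (A * Y))ᴴ := by rw [conjTranspose_mul (A * X)]
      _ = A * Y := by rw [← Matrix.mul_assoc, hX.mul_mul_self, hY.conjTranspose_left]
  have h2 : X * A = Y * A := by
    calc X * A = (X * A) * (Y * A) := by
          rw [Matrix.mul_assoc, ← Matrix.mul_assoc A, hY.mul_mul_self]
      _ = (X * A)ᴴ * (Y * A)ᴴ := by rw [hY.conjTranspose_right, hX.conjTranspose_right]
      _ = (Y * A * (X * A))ᴴ := by rw [conjTranspose_mul (Y * A)]
      _ = Y * A := by
          rw [Matrix.mul_assoc, ← Matrix.mul_assoc A, hX.mul_mul_self, hY.conjTranspose_right]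
  calc Y = Y * A * Y := hY.self_mul_mul.symm
    _ = X * A * X := by rw [← h2, Matrix.mul_assoc, ← h1, Matrix.mul_assoc]
    _ = X := hX.self_mul_mul

/-- The Moore-Penrose inverse `A^†`. -/
def moorePenrose {q n : Type*} [Fintype q] [Fintype n] (A : Matrix q n ℂ) : Matrix n q ℂ :=
  (existsUnique_isMoorePenrose A).choose

theorem isMoorePenrose_moorePenrose {q n : Type*} [Fintype q] [Fintype n] (A : Matrix q n ℂ) :
    IsMoorePenrose A A.moorePenrose :=
  (existsUnique_isMoorePenrose A).choose_spec.1

/-! ### Range space and orthogonal projector onto it -/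

/-- The range space `R(B) = {Bx}`, as a subspace of the Hermitian space `ℂ^q`. -/
def rangeSpace {q n : Type*} [Fintype n] [DecidableEq n] (B : Matrix q n ℂ) :
    Submodule ℂ (EuclideanSpace ℂ q) :=
  LinearMap.range (toEuclideanLin B)

/-- The matrix `P_T` of the orthogonal projector of `ℂ^q` onto the subspace `T`. -/
def orthProj {q : Type*} [Fintype q] [DecidableEq q] (T : Submodule ℂ (EuclideanSpace ℂ q)) :
    Matrix q q ℂ :=
  (toEuclideanCLM (n := q) (𝕜 := ℂ)).symm T.starProjection

theorem rangeSpace_le_iff {q n p : Type*} [Fintype n] [DecidableEq n]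
    [Fintype p] [DecidableEq p] (X : Matrix q p ℂ) (B : Matrix q n ℂ) :
    X.rangeSpace ≤ B.rangeSpace ↔ ∃ Z : Matrix n p ℂ, X = B * Z := by
  constructor
  · intro h
    have hz : ∀ j : p, ∃ z : n → ℂ, B *ᵥ z = X.col j := by
      intro j
      have hj : toEuclideanLin X (WithLp.toLp 2 (Pi.single j 1)) ∈ B.rangeSpace :=
        h (LinearMap.mem_range_self _ _)
      obtain ⟨z, hz⟩ := hj
      refine ⟨z.ofLp, ?_⟩
      have := congrArg WithLp.ofLp hz
      simpa using this
    choose z hz using hz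
    refine ⟨of fun i j => z j i, ?_⟩
    ext i j
    have := congrFun (hz j) i
    simp only [col_apply] at this
    rw [← this]
    rfl
  · rintro ⟨Z, rfl⟩ _ ⟨v, rfl⟩
    refine ⟨WithLp.toLp 2 (Z *ᵥ v.ofLp), ?_⟩
    apply (WithLp.ofLp_injective 2)
    simp

theorem orthProj_rangeSpace_mul {q n : Type*} [Fintype q] [DecidableEq q] [Fintype n]
    [DecidableEq n] (B : Matrix q n ℂ) : orthProj B.rangeSpace * B = B := by
  ext i j
  have hj : toEuclideanLin B (WithLp.toLp 2 (Pi.single j 1)) ∈ B.rangeSpace :=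
    LinearMap.mem_range_self _ _
  have h := Submodule.starProjection_eq_self_iff.2 hj
  have h2 : toEuclideanCLM (n := q) (𝕜 := ℂ) (orthProj B.rangeSpace)
      = B.rangeSpace.starProjection := by
    simp [orthProj]
  rw [← h2] at h
  have := congrFun (congrArg WithLp.ofLp h) i
  have h3 : (orthProj B.rangeSpace *ᵥ B.col j) i = B i j := by
    simpa using this
  exact h3

theorem rangeSpace_orthProj_le {q : Type*} [Fintype q] [DecidableEq q]
    (T : Submodule ℂ (EuclideanSpace ℂ q)) : (orthProj T).rangeSpace ≤ T := by
  rintro _ ⟨v, rfl⟩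
  have h2 : toEuclideanCLM (n := q) (𝕜 := ℂ) (orthProj T) = T.starProjection := by
    simp [orthProj]
  rw [← coe_toEuclideanCLM_eq_toEuclideanLin, h2]
  exact Submodule.starProjection_apply_mem T v

/-! ### Index -/

/-- The index of a square matrix: the least `k ≥ 0` with `rank (B^k) = rank (B^(k+1))`. -/
def index {n : Type*} [Fintype n] [DecidableEq n] (B : Matrix n n ℂ) : ℕ :=
  sInf {k : ℕ | (B ^ k).rank = (B ^ (k + 1)).rank}

theorem rank_pow_index {n : Type*} [Fintype n] [DecidableEq n] (B : Matrix n n ℂ) :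
    (B ^ B.index).rank = (B ^ (B.index + 1)).rank := by
  have hne : {k : ℕ | (B ^ k).rank = (B ^ (k + 1)).rank}.Nonempty := by
    by_contra hcon
    rw [Set.not_nonempty_iff_eq_empty, Set.eq_empty_iff_forall_notMem] at hcon
    have hlt : ∀ k, (B ^ (k + 1)).rank < (B ^ k).rank := fun k =>
      lt_of_le_of_ne (by rw [pow_succ]; exact rank_mul_le_left _ _) (fun h => hcon k h.symm)
    exact not_strictAnti_of_wellFoundedLT (fun k => (B ^ k).rank) (strictAnti_nat_of_succ_lt hlt)
  exact Nat.sInf_mem hne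

theorem exists_pow_eq_pow_mul {n : Type*} [Fintype n] [DecidableEq n] (B : Matrix n n ℂ)
    {k : ℕ} (hk : B.index ≤ k) (s : ℕ) : ∃ Y, B ^ k = B ^ (k + s) * Y := by
  have base : ∃ Y, B ^ B.index = B ^ (B.index + 1) * Y := by
    rw [← rangeSpace_le_iff]
    have hle : (B ^ (B.index + 1)).rangeSpace ≤ (B ^ B.index).rangeSpace := by
      rw [rangeSpace_le_iff]
      exact ⟨B, pow_succ _ _⟩
    refine (Submodule.eq_of_le_of_finrank_eq hle ?_).ge
    have h := rank_pow_index B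
    rw [rank_eq_finrank_range_toLin _ (EuclideanSpace.basisFun n ℂ).toBasis
      (EuclideanSpace.basisFun n ℂ).toBasis, rank_eq_finrank_range_toLin (B ^ (B.index + 1))
      (EuclideanSpace.basisFun n ℂ).toBasis (EuclideanSpace.basisFun n ℂ).toBasis] at h
    simp only [rangeSpace, toEuclideanLin_eq_toLin_orthonormal]
    exact h.symm
  obtain ⟨Y, hY⟩ := base
  obtain ⟨d, rfl⟩ := Nat.exists_eq_add_of_le hk
  have step : B ^ (B.index + d) = B ^ (B.index + d + 1) * Y := by
    calc B ^ (B.index + d) = B ^ d * B ^ B.index := by rw [add_comm, pow_add]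
      _ = B ^ d * B ^ (B.index + 1) * Y := by
          rw [Matrix.mul_assoc]
          exact congrArg (B ^ d * ·) hY
      _ = _ := by rw [← pow_add]; congr 2; omega
  induction s with
  | zero => exact ⟨1, by simp⟩
  | succ s ih =>
    obtain ⟨Z, hZ⟩ := ih
    refine ⟨Y * Z, ?_⟩
    have : B ^ (B.index + d + s) = B ^ (B.index + d + (s + 1)) * Y := by
      rw [add_comm _ s, pow_add, step, ← Matrix.mul_assoc, ← pow_add]
      congr 2
      omega
    rw [← Matrix.mul_assoc, ← this]
    exact hZ

theorem index_transpose {n : Type*} [Fintype n] [DecidableEq n] (B : Matrix n n ℂ) :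
    Bᵀ.index = B.index := by
  simp only [index, ← transpose_pow, rank_transpose]

theorem exists_pow_eq_mul_pow {n : Type*} [Fintype n] [DecidableEq n] (B : Matrix n n ℂ)
    {k : ℕ} (hk : B.index ≤ k) (s : ℕ) : ∃ Y, B ^ k = Y * B ^ (k + s) := by
  obtain ⟨Y, hY⟩ := exists_pow_eq_pow_mul Bᵀ (B.index_transpose.trans_le hk) s
  refine ⟨Yᵀ, ?_⟩
  have := congrArg transpose hY
  simpa [transpose_mul, transpose_pow] using this

theorem exists_drazin {n : Type*} [Fintype n] [DecidableEq n] (B : Matrix n n ℂ)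
    {k : ℕ} (hk : B.index ≤ k) :
    ∃ D, B * D = D * B ∧ D * B * D = D ∧ B ^ (k + 1) * D = B ^ k := by
  obtain ⟨Y, hY⟩ := exists_pow_eq_pow_mul B hk (k + 1)
  obtain ⟨Z, hZ⟩ := exists_pow_eq_mul_pow B hk (k + 1)
  obtain ⟨G, hG⟩ : ∃ G, B ^ (k + (k + 1)) * G * B ^ (k + (k + 1)) = B ^ (k + (k + 1)) :=
    ⟨_, (isMoorePenrose_moorePenrose _).mul_mul_self⟩
  set M := B ^ (k + (k + 1)) with hM
  have hBM : B * M = M * B := by rw [hM, ← pow_succ', pow_succ]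
  have hBk : B * B ^ k = B ^ k * B := by rw [← pow_succ', pow_succ]
  have hD1 : B ^ k * G * B ^ k = Z * M * Y := by
    calc B ^ k * G * B ^ k = Z * M * G * (M * Y) := by rw [← hZ, ← hY]
      _ = Z * (M * G * M) * Y := by simp only [Matrix.mul_assoc]
      _ = _ := by rw [hG]
  refine ⟨B ^ k * G * B ^ k, ?_, ?_, ?_⟩
  · rw [hD1]
    calc B * (Z * M * Y) = B * B ^ k * Y := by rw [← hZ, Matrix.mul_assoc]
      _ = Z * M * B * Y := by rw [hBk, hZ]
      _ = Z * B * (M * Y) := by rw [Matrix.mul_assoc Z, ← hBM]; simp only [Matrix.mul_assoc]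
      _ = Z * (B * B ^ k) := by rw [← hY, Matrix.mul_assoc]
      _ = Z * (B ^ k * B) := by rw [hBk]
      _ = Z * M * Y * B := by rw [hY]; simp only [Matrix.mul_assoc]
  · calc B ^ k * G * B ^ k * B * (B ^ k * G * B ^ k)
        = B ^ k * G * (B ^ k * B * B ^ k) * G * B ^ k := by simp only [Matrix.mul_assoc]
      _ = Z * M * G * M * G * B ^ k := by
          rw [← hZ, ← pow_succ, ← pow_add, hM]
          congr 4
          omega
      _ = Z * (M * G * M) * G * B ^ k := by simp only [Matrix.mul_assoc]
      _ = _ := by rw [hG, ← hZ]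
  · calc B ^ (k + 1) * (B ^ k * G * B ^ k) = B ^ (k + 1) * B ^ k * G * B ^ k := by
          simp only [Matrix.mul_assoc]
      _ = M * G * (M * Y) := by
          rw [← hY, ← pow_add, hM]
          congr 3
          omega
      _ = M * G * M * Y := by simp only [Matrix.mul_assoc]
      _ = B ^ k := by rw [hG, ← hY]

/-! ### Powers for the `W`-product `A ⋆ B = A W B` -/

/-- `A^{⋆l} = A ⋆ ⋯ ⋆ A` (`l` factors, `l ≥ 1`). The value at `l = 0` has no meaning; the
expressions `A^{⋆0} W` and `W A^{⋆0}` are covered by `wPowMul` and `mulWPow`. -/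
def wPow {q n : Type*} [Fintype q] [Fintype n]
    (A : Matrix q n ℂ) (W : Matrix n q ℂ) : ℕ → Matrix q n ℂ
  | 0 => 0
  | 1 => A
  | l + 2 => wPow A W (l + 1) * W * A

/-- `A^{⋆l} W`, where `A^{⋆0} W = I_q`. -/
def wPowMul {q n : Type*} [Fintype q] [DecidableEq q] [Fintype n]
    (A : Matrix q n ℂ) (W : Matrix n q ℂ) : ℕ → Matrix q q ℂ
  | 0 => 1
  | l + 1 => wPow A W (l + 1) * W

/-- `W A^{⋆l}`, where `W A^{⋆0} = I_n`. -/
def mulWPow {q n : Type*} [Fintype q] [Fintype n] [DecidableEq n]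
    (A : Matrix q n ℂ) (W : Matrix n q ℂ) : ℕ → Matrix n n ℂ
  | 0 => 1
  | l + 1 => W * wPow A W (l + 1)

/-! ### Weighted generalized inverses -/

/-- `max {Ind(AW), Ind(WA)}`. -/
def wIndex {q n : Type*} [Fintype q] [DecidableEq q] [Fintype n] [DecidableEq n]
    (A : Matrix q n ℂ) (W : Matrix n q ℂ) : ℕ :=
  max (A * W).index (W * A).index

/-- `X` satisfies the equations defining the `W`-weighted Drazin inverse of `A`. -/
structure IsWDrazin {q n : Type*} [Fintype q] [DecidableEq q] [Fintype n] [DecidableEq n]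
    (A : Matrix q n ℂ) (W : Matrix n q ℂ) (X : Matrix q n ℂ) : Prop where
  pow_eq : (A * W) ^ wIndex A W = (A * W) ^ (wIndex A W + 1) * X * W
  eq_mul : X = X * W * A * W * X
  comm : A * W * X = X * W * A

theorem drazin_eq_pow_mul {R : Type*} [Monoid R] {b d : R} (hc : b * d = d * b)
    (hd : d * b * d = d) (j : ℕ) : d = b ^ j * d ^ (j + 1) := by
  induction j with
  | zero => simp
  | succ j ih =>
    calc d = b * d * d := by rw [hc, hd]
      _ = b * (b ^ j * d ^ (j + 1)) * d := by rw [← ih]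
      _ = _ := by rw [pow_succ' b, pow_succ d (j + 1)]; simp only [mul_assoc]

theorem drazin_unique {R : Type*} [Monoid R] {b d e : R} {k : ℕ} (hc : b * d = d * b)
    (hd : d * b * d = d) (hk : b ^ (k + 1) * d = b ^ k) (hc' : b * e = e * b)
    (hd' : e * b * e = e) (hk' : b ^ (k + 1) * e = b ^ k) : d = e := by
  have h1 : e * b * d = d := by
    have h := drazin_eq_pow_mul hc hd k
    have hcomm : b ^ (k + 1) * e = e * b ^ (k + 1) := (Commute.pow_left hc' _).eq
    calc e * b * d = e * b * (b ^ k * d ^ (k + 1)) := by rw [← h]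
      _ = e * b ^ (k + 1) * d ^ (k + 1) := by rw [pow_succ' b]; simp only [mul_assoc]
      _ = d := by rw [← hcomm, hk', ← h]
  have h2 : e * b * d = e := by
    have h : e = e ^ (k + 1) * b ^ k := by
      rw [← (Commute.pow_pow (show Commute b e from hc') k (k + 1)).eq]
      exact drazin_eq_pow_mul hc' hd' k
    calc e * b * d = e ^ (k + 1) * b ^ k * b * d := by rw [← h]
      _ = e ^ (k + 1) * (b ^ (k + 1) * d) := by rw [pow_succ b]; simp only [mul_assoc]
      _ = e := by rw [hk, ← h]
  rw [← h1, h2]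

theorem existsUnique_isWDrazin {q n : Type*} [Fintype q] [DecidableEq q] [Fintype n]
    [DecidableEq n] (A : Matrix q n ℂ) (W : Matrix n q ℂ) :
    ∃! X : Matrix q n ℂ, IsWDrazin A W X := by
  obtain ⟨D, hc, hD, hk⟩ := exists_drazin (A * W) (k := wIndex A W) (le_max_left _ _)
  have hDD : D * D * (A * W) = D := by rw [Matrix.mul_assoc, ← hc, ← Matrix.mul_assoc, hD]
  refine ⟨D * D * A, ⟨?_, ?_, ?_⟩, ?_⟩
  · calc (A * W) ^ wIndex A W = (A * W) ^ (wIndex A W + 1) * (D * D * (A * W)) := by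
          rw [hDD, hk]
      _ = _ := by simp only [Matrix.mul_assoc]
  · calc D * D * A = D * (D * (A * W) * D) * A := by rw [hD]
      _ = D * D * (A * W) * D * A := by simp only [Matrix.mul_assoc]
      _ = D * D * (A * W) * (D * (A * W) * D) * A := by rw [hD]
      _ = D * D * (A * W) * ((A * W * D) * D) * A := by rw [hc]
      _ = _ := by simp only [Matrix.mul_assoc]
  · calc A * W * (D * D * A) = A * W * D * D * A := by simp only [Matrix.mul_assoc]
      _ = D * D * (A * W) * A := by rw [hc, hD, hDD]
      _ = _ := by simp only [Matrix.mul_assoc]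
  · intro X h
    have hXc : A * W * (X * W) = X * W * (A * W) := by
      rw [← Matrix.mul_assoc, h.comm]
      simp only [Matrix.mul_assoc]
    have hX : X * W = D := by
      refine drazin_unique (b := A * W) (k := wIndex A W) hXc ?_ ?_ hc hD hk
      · calc X * W * (A * W) * (X * W) = X * W * A * W * X * W := by
              simp only [Matrix.mul_assoc]
          _ = X * W := by rw [← h.eq_mul]
      · rw [← Matrix.mul_assoc]
        exact h.pow_eq.symm
    calc X = X * W * A * W * X := h.eq_mul
      _ = X * W * (A * W * X) := by simp only [Matrix.mul_assoc]
      _ = X * W * (X * W) * A := by rw [h.comm]; simp only [Matrix.mul_assoc]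
      _ = D * D * A := by rw [hX]

/-- The `W`-weighted Drazin inverse `A^{D,W}`. -/
def wDrazin {q n : Type*} [Fintype q] [DecidableEq q] [Fintype n] [DecidableEq n]
    (A : Matrix q n ℂ) (W : Matrix n q ℂ) : Matrix q n ℂ :=
  (existsUnique_isWDrazin A W).choose

theorem isWDrazin_wDrazin {q n : Type*} [Fintype q] [DecidableEq q] [Fintype n] [DecidableEq n]
    (A : Matrix q n ℂ) (W : Matrix n q ℂ) : IsWDrazin A W (wDrazin A W) :=
  (existsUnique_isWDrazin A W).choose_spec.1

/-- The `W`-weighted group inverse `A^{#,W}`: the `W`-weighted Drazin inverse in the case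
`max {Ind(AW), Ind(WA)} ≤ 1`; it is not defined otherwise. -/
def wGroupInverse {q n : Type*} [Fintype q] [DecidableEq q] [Fintype n] [DecidableEq n]
    (A : Matrix q n ℂ) (W : Matrix n q ℂ) (_h : wIndex A W ≤ 1) : Matrix q n ℂ :=
  wDrazin A W

/-- `X` satisfies the conditions defining the weighted core-EP inverse of `A`. -/
structure IsWCoreEP {q n : Type*} [Fintype q] [DecidableEq q] [Fintype n] [DecidableEq n]
    (A : Matrix q n ℂ) (W : Matrix n q ℂ) (X : Matrix q n ℂ) : Prop where
  mul_eq : W * A * W * X = orthProj ((W * A) ^ wIndex A W).rangeSpace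
  range_le : X.rangeSpace ≤ ((A * W) ^ wIndex A W).rangeSpace

theorem mul_pow_comm_left {q n : Type*} [Fintype q] [DecidableEq q] [Fintype n] [DecidableEq n]
    (A : Matrix q n ℂ) (W : Matrix n q ℂ) (k : ℕ) : W * (A * W) ^ k = (W * A) ^ k * W := by
  induction k with
  | zero => simp
  | succ k ih =>
    calc W * (A * W) ^ (k + 1) = W * (A * W) ^ k * A * W := by
          rw [pow_succ]; simp only [Matrix.mul_assoc]
      _ = _ := by rw [ih, pow_succ]; simp only [Matrix.mul_assoc]

theorem eq_zero_of_weighted {q n : Type*} [Fintype q] [DecidableEq q] [Fintype n]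
    [DecidableEq n] {A : Matrix q n ℂ} {W : Matrix n q ℂ} {Y : Matrix q n ℂ}
    (h0 : W * A * W * Y = 0) (hr : Y.rangeSpace ≤ ((A * W) ^ wIndex A W).rangeSpace) : Y = 0 := by
  obtain ⟨Z, rfl⟩ := (rangeSpace_le_iff _ _).1 hr
  obtain ⟨V, hV⟩ := exists_pow_eq_mul_pow (A * W) (k := wIndex A W) (le_max_left _ _) 2
  calc (A * W) ^ wIndex A W * Z = V * (A * W) ^ (wIndex A W + 2) * Z := by rw [← hV]
    _ = V * A * (W * A * W * ((A * W) ^ wIndex A W * Z)) := by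
        rw [add_comm, pow_add, pow_two]; simp only [Matrix.mul_assoc]
    _ = 0 := by rw [h0, Matrix.mul_zero]

theorem IsWCoreEP.unique {q n : Type*} [Fintype q] [DecidableEq q] [Fintype n]
    [DecidableEq n] {A : Matrix q n ℂ} {W : Matrix n q ℂ} {X Y : Matrix q n ℂ}
    (hX : IsWCoreEP A W X) (hY : IsWCoreEP A W Y) : X = Y := by
  rw [← sub_eq_zero]
  apply eq_zero_of_weighted (A := A) (W := W)
  · rw [Matrix.mul_sub, hX.mul_eq, hY.mul_eq, sub_self]
  · obtain ⟨Z, hZ⟩ := (rangeSpace_le_iff _ _).1 hX.range_le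
    obtain ⟨V, hV⟩ := (rangeSpace_le_iff _ _).1 hY.range_le
    exact (rangeSpace_le_iff _ _).2 ⟨Z - V, by rw [Matrix.mul_sub, ← hZ, ← hV]⟩

theorem existsUnique_isWCoreEP {q n : Type*} [Fintype q] [DecidableEq q] [Fintype n]
    [DecidableEq n] (A : Matrix q n ℂ) (W : Matrix n q ℂ) :
    ∃! X : Matrix q n ℂ, IsWCoreEP A W X := by
  obtain ⟨Y, hY⟩ := exists_pow_eq_pow_mul (W * A) (k := wIndex A W) (le_max_right _ _) 3
  obtain ⟨Q, hQ⟩ := (rangeSpace_le_iff _ _).1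
    (rangeSpace_orthProj_le ((W * A) ^ wIndex A W).rangeSpace)
  have hcomm : (W * A) ^ (wIndex A W + 3) * Y * Q
      = W * A * W * ((A * W) ^ (wIndex A W) * A * (W * A) * Y * Q) := by
    have h := mul_pow_comm_left A W (wIndex A W)
    calc (W * A) ^ (wIndex A W + 3) * Y * Q
        = W * A * ((W * A) ^ wIndex A W * W * A * (W * A)) * Y * Q := by
          rw [show wIndex A W + 3 = 1 + wIndex A W + 2 by omega, pow_add, pow_add, pow_one,
            pow_two]
          simp only [Matrix.mul_assoc]
      _ = _ := by rw [← h]; simp only [Matrix.mul_assoc]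
  have hex : IsWCoreEP A W ((A * W) ^ (wIndex A W) * A * (W * A) * Y * Q) := by
    refine ⟨?_, ?_⟩
    · rw [← hcomm, ← hY, ← hQ]
    · refine (rangeSpace_le_iff _ _).2 ⟨A * (W * A) * Y * Q, ?_⟩
      simp only [Matrix.mul_assoc]
  exact ⟨_, hex, fun X hX => hX.unique hex⟩

/-- The weighted core-EP inverse `A^{ⓓ,W}` (circled dagger). -/
def wCoreEP {q n : Type*} [Fintype q] [DecidableEq q] [Fintype n] [DecidableEq n]
    (A : Matrix q n ℂ) (W : Matrix n q ℂ) : Matrix q n ℂ :=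
  (existsUnique_isWCoreEP A W).choose

theorem isWCoreEP_wCoreEP {q n : Type*} [Fintype q] [DecidableEq q] [Fintype n] [DecidableEq n]
    (A : Matrix q n ℂ) (W : Matrix n q ℂ) : IsWCoreEP A W (wCoreEP A W) :=
  (existsUnique_isWCoreEP A W).choose_spec.1

/-- `X` satisfies the equations defining the `W`-weighted weak group inverse of `A`. -/
structure IsWWeakGroup {q n : Type*} [Fintype q] [DecidableEq q] [Fintype n] [DecidableEq n]
    (A : Matrix q n ℂ) (W : Matrix n q ℂ) (X : Matrix q n ℂ) : Prop where
  mul_wPow : A * W * wPow X W 2 = X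
  mul_eq : A * W * X = wCoreEP A W * W * A

theorem existsUnique_isWWeakGroup {q n : Type*} [Fintype q] [DecidableEq q] [Fintype n]
    [DecidableEq n] (A : Matrix q n ℂ) (W : Matrix n q ℂ) :
    ∃! X : Matrix q n ℂ, IsWWeakGroup A W X := by
  have hC := isWCoreEP_wCoreEP A W
  set C := wCoreEP A W with hCdef
  have hACC : A * W * C * W * C = C := by
    refine IsWCoreEP.unique ⟨?_, ?_⟩ hC
    · obtain ⟨Z, hZ⟩ := (rangeSpace_le_iff _ _).1 hC.range_le
      have hP := orthProj_rangeSpace_mul ((W * A) ^ wIndex A W)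
      have hWC : W * C = (W * A) ^ wIndex A W * (W * Z) := by
        rw [← Matrix.mul_assoc, ← mul_pow_comm_left, Matrix.mul_assoc, ← hZ]
      calc W * A * W * (A * W * C * W * C) = W * A * (W * A * W * C) * (W * C) := by
            simp only [Matrix.mul_assoc]
        _ = W * A * (orthProj ((W * A) ^ wIndex A W).rangeSpace * (W * A) ^ wIndex A W)
              * (W * Z) := by rw [hC.mul_eq, hWC]; simp only [Matrix.mul_assoc]
        _ = W * A * (W * C) := by rw [hP, hWC]; simp only [Matrix.mul_assoc]
        _ = _ := by rw [← Matrix.mul_assoc, hC.mul_eq]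
    · obtain ⟨Z, hZ⟩ := (rangeSpace_le_iff _ _).1 hC.range_le
      refine (rangeSpace_le_iff _ _).2 ⟨A * W * Z * W * C, ?_⟩
      calc A * W * C * W * C = A * W * ((A * W) ^ wIndex A W * Z) * W * C := by rw [← hZ]
        _ = A * W * (A * W) ^ wIndex A W * Z * W * C := by simp only [Matrix.mul_assoc]
        _ = (A * W) ^ wIndex A W * (A * W) * Z * W * C := by rw [← pow_succ', pow_succ]
        _ = _ := by simp only [Matrix.mul_assoc]
  refine ⟨C * W * C * W * A, ⟨?_, ?_⟩, ?_⟩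
  · calc A * W * wPow (C * W * C * W * A) W 2
        = A * W * C * W * C * W * (A * W * C * W * C) * W * A := by
          simp only [wPow, Matrix.mul_assoc]
      _ = C * W * C * W * A := by rw [hACC]
  · calc A * W * (C * W * C * W * A) = A * W * C * W * C * W * A := by
          simp only [Matrix.mul_assoc]
      _ = C * W * A := by rw [hACC]
  · intro X hX
    have h1 : A * W * X * W * X = X := by
      have := hX.mul_wPow
      simpa only [wPow, Matrix.mul_assoc] using this
    calc X = A * W * X * W * X := h1.symm
      _ = C * W * A * W * X := by rw [hX.mul_eq]
      _ = C * W * (A * W * X) := by simp only [Matrix.mul_assoc]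
      _ = C * W * C * W * A := by rw [hX.mul_eq, ← hCdef]; simp only [Matrix.mul_assoc]

/-- The `W`-weighted weak group inverse `A^{ⓦ,W}`. -/
def wWeakGroup {q n : Type*} [Fintype q] [DecidableEq q] [Fintype n] [DecidableEq n]
    (A : Matrix q n ℂ) (W : Matrix n q ℂ) : Matrix q n ℂ :=
  (existsUnique_isWWeakGroup A W).choose

theorem isWWeakGroup_wWeakGroup {q n : Type*} [Fintype q] [DecidableEq q] [Fintype n]
    [DecidableEq n] (A : Matrix q n ℂ) (W : Matrix n q ℂ) :
    IsWWeakGroup A W (wWeakGroup A W) :=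
  (existsUnique_isWWeakGroup A W).choose_spec.1

/-- The `W`-weighted `m`-weak group inverse
`A^{ⓦ_m,W} = (A^{ⓓ,W})^{⋆(m+1)} W A^{⋆m}`, for `m ≥ 1`. -/
def wmWeakGroup {q n : Type*} [Fintype q] [DecidableEq q] [Fintype n] [DecidableEq n]
    (m : ℕ) (A : Matrix q n ℂ) (W : Matrix n q ℂ) : Matrix q n ℂ :=
  wPow (wCoreEP A W) W (m + 1) * mulWPow A W m

/-- The `m`-weak group inverse `B^{ⓦ_m}` of a square matrix: the case `W = I`. -/
def mWeakGroup {n : Type*} [Fintype n] [DecidableEq n] (m : ℕ) (B : Matrix n n ℂ) :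
    Matrix n n ℂ :=
  wmWeakGroup m B 1

end Matrix

end

/-! Write C for the core-EP inverse of A and k for max {Ind(AW), Ind(WA)}. Two cancellation laws
drive everything: CW·AW is the identity on R((AW)^k) (`wCoreEP_pow_cancel_left`), and A ⋆ C ⋆ C = C,
so that every factor AW on the left strips one factor from a ⋆-power of C
(`wCoreEP_pow_cancel_right`). They show that C^{⋆(j+1)} is the only X with W(AW)^{j+1}X =
P_{R((WA)^k)} and R(X) ⊆ R((AW)^k) (`eq_wPow_wCoreEP`).

Claims 1 and 2 follow by testing their candidates for C^{⋆(m+1)} against this characterization. In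
claim 3 both products of C^{⋆(m+1)} with the given matrix are orthogonal projectors, so the Penrose
equations hold. Claims 4 and 5 use that the weak group inverse is C ⋆ C WA and that ⋆-powers commute
with taking the core-EP inverse. For claim 6, C^{⋆(m+1)}WA is the group inverse of G, and both
products equal CWA. Claim 7 rests on WC being the core-EP inverse of WA with weight I. -/

namespace Matrix

/-! ### Orthogonal projectors, ranges of powers, index. -/

theorem orthProj_conjTranspose {q : Type*} [Fintype q] [DecidableEq q]
    (T : Submodule ℂ (EuclideanSpace ℂ q)) : (orthProj T)ᴴ = orthProj T := by
  have h : star T.starProjection = T.starProjection := isSelfAdjoint_starProjection T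
  rw [← star_eq_conjTranspose, orthProj]
  exact ((toEuclideanCLM (n := q) (𝕜 := ℂ)).symm.map_star' T.starProjection).symm.trans
    (congrArg (toEuclideanCLM (n := q) (𝕜 := ℂ)).symm h)

theorem orthProj_mul_of_rangeSpace_le {q n p : Type*} [Fintype q] [DecidableEq q] [Fintype n]
    [DecidableEq n] [Fintype p] [DecidableEq p] {B : Matrix q n ℂ} {Y : Matrix q p ℂ}
    (h : Y.rangeSpace ≤ B.rangeSpace) : orthProj B.rangeSpace * Y = Y := by
  obtain ⟨Z, rfl⟩ := (rangeSpace_le_iff _ _).1 h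
  rw [← Matrix.mul_assoc, orthProj_rangeSpace_mul]

/-- Write P for the projector onto R(N). NN† fixes R(N), so NN†P = P; taking adjoints of these
self-adjoint matrices gives P·NN† = P, and PN = N turns the left side into NN†. -/
theorem mul_moorePenrose {q n : Type*} [Fintype q] [DecidableEq q] [Fintype n] [DecidableEq n]
    (N : Matrix q n ℂ) : N * N.moorePenrose = orthProj N.rangeSpace := by
  have hN := isMoorePenrose_moorePenrose N
  obtain ⟨Z, hZ⟩ := (rangeSpace_le_iff _ _).1 (rangeSpace_orthProj_le N.rangeSpace)
  have h1 : N * N.moorePenrose * orthProj N.rangeSpace = orthProj N.rangeSpace := by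
    rw [hZ, ← Matrix.mul_assoc, hN.mul_mul_self]
  have h2 := congrArg conjTranspose h1
  rw [conjTranspose_mul, hN.conjTranspose_left, orthProj_conjTranspose, ← Matrix.mul_assoc,
    orthProj_rangeSpace_mul] at h2
  exact h2

theorem IsMoorePenrose.eq_moorePenrose {q n : Type*} [Fintype q] [Fintype n]
    {M : Matrix q n ℂ} {X : Matrix n q ℂ} (h : IsMoorePenrose M X) : M.moorePenrose = X :=
  (existsUnique_isMoorePenrose M).unique (isMoorePenrose_moorePenrose M) h

theorem rangeSpace_pow_eq {n : Type*} [Fintype n] [DecidableEq n] (B : Matrix n n ℂ) {i j : ℕ}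
    (hi : B.index ≤ i) (hj : B.index ≤ j) : (B ^ i).rangeSpace = (B ^ j).rangeSpace := by
  have key : ∀ {i j : ℕ}, B.index ≤ i → (B ^ i).rangeSpace ≤ (B ^ j).rangeSpace := by
    intro i j hi
    obtain ⟨Y, hY⟩ := exists_pow_eq_pow_mul B hi j
    refine (rangeSpace_le_iff _ _).2 ⟨B ^ i * Y, ?_⟩
    rw [← Matrix.mul_assoc, ← pow_add, add_comm, ← hY]
  exact le_antisymm (key hi) (key hj)

theorem rangeSpace_pow_pow_eq {n : Type*} [Fintype n] [DecidableEq n] (B : Matrix n n ℂ)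
    {m i j : ℕ} (hm : 1 ≤ m) (hi : (B ^ m).index ≤ i) (hj : B.index ≤ j) :
    ((B ^ m) ^ i).rangeSpace = (B ^ j).rangeSpace := by
  -- Enlarging the exponent from i to i + j makes m(i + j) ≥ j ≥ Ind(B) evident.
  rw [rangeSpace_pow_eq (B ^ m) hi (hi.trans (Nat.le_add_right i j)), ← pow_mul]
  exact rangeSpace_pow_eq B (by nlinarith) hj

theorem index_le_one_of_eq {n : Type*} [Fintype n] [DecidableEq n] {B Y : Matrix n n ℂ}
    (h : B = B * B * Y) : B.index ≤ 1 := by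
  refine Nat.sInf_le (le_antisymm ?_ ?_)
  · rw [pow_one, one_add_one_eq_two, pow_two]
    conv_lhs => rw [h]
    exact rank_mul_le_left _ _
  · rw [pow_succ]
    exact rank_mul_le_left _ _

/-! ### ⋆-powers and cancellation laws for the core-EP inverse. -/

section Weighted

variable {q n : Type*} [Fintype q] [DecidableEq q] [Fintype n]

theorem wPow_succ (A : Matrix q n ℂ) (W : Matrix n q ℂ) (l : ℕ) :
    wPow A W (l + 1) = (A * W) ^ l * A := by
  induction l with
  | zero => simp [wPow]
  | succ l ih => rw [wPow, ih, pow_succ]; simp only [Matrix.mul_assoc]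

theorem wPowMul_eq (A : Matrix q n ℂ) (W : Matrix n q ℂ) (l : ℕ) :
    wPowMul A W l = (A * W) ^ l := by
  cases l with
  | zero => simp [wPowMul]
  | succ l => rw [wPowMul, wPow_succ, pow_succ]; simp only [Matrix.mul_assoc]

theorem wPow_mul_right (A : Matrix q n ℂ) (W : Matrix n q ℂ) (m : ℕ) :
    wPow A W (m + 1) * W = (A * W) ^ (m + 1) := by
  rw [wPow_succ, pow_succ, Matrix.mul_assoc]

/-- Each AW on the left absorbs one ⋆-factor, as long as one remains. X is kept general because both
the core-EP and the Drazin inverse satisfy the hypothesis. -/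
theorem pow_mul_wPow_cancel {A X : Matrix q n ℂ} {W : Matrix n q ℂ}
    (h : A * W * (X * W * X) = X) (j i : ℕ) :
    (A * W) ^ j * wPow X W (j + i + 1) = wPow X W (i + 1) := by
  have hs : ∀ l : ℕ, (A * W) * ((X * W) ^ (l + 1) * X) = (X * W) ^ l * X := by
    intro l
    cases l with
    | zero => simpa [Matrix.mul_assoc] using h
    | succ l =>
      calc (A * W) * ((X * W) ^ (l + 1 + 1) * X)
          = A * W * (X * W * X) * (W * (X * W) ^ l * X) := by
            rw [pow_succ', pow_succ']; simp only [Matrix.mul_assoc]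
        _ = _ := by rw [h, pow_succ']; simp only [Matrix.mul_assoc]
  induction j with
  | zero => simp
  | succ j ih =>
    rw [← ih, pow_succ, Matrix.mul_assoc, wPow_succ, wPow_succ,
      show j + 1 + i = j + i + 1 by omega, hs]

variable [DecidableEq n]

theorem mulWPow_eq (A : Matrix q n ℂ) (W : Matrix n q ℂ) (l : ℕ) :
    mulWPow A W l = (W * A) ^ l := by
  cases l with
  | zero => simp [mulWPow]
  | succ l =>
    rw [mulWPow, wPow_succ, ← Matrix.mul_assoc, mul_pow_comm_left, pow_succ]
    simp only [Matrix.mul_assoc]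

theorem wCoreEP_eq_pow_mul (A : Matrix q n ℂ) (W : Matrix n q ℂ) :
    ∃ Z : Matrix q n ℂ, wCoreEP A W = (A * W) ^ wIndex A W * Z :=
  (rangeSpace_le_iff _ _).1 (isWCoreEP_wCoreEP A W).range_le

/-- WAW can be cancelled on R((AW)^k). After multiplication by it, WAWC is the projector onto
R((WA)^k), which fixes W(AW)^{k+1} = (WA)^k WAW. -/
theorem wCoreEP_cancel_left (A : Matrix q n ℂ) (W : Matrix n q ℂ) :
    wCoreEP A W * W * (A * W) * (A * W) ^ wIndex A W = (A * W) ^ wIndex A W := by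
  have hC := isWCoreEP_wCoreEP A W
  obtain ⟨Z, hZ⟩ := wCoreEP_eq_pow_mul A W
  have h1 : W * (A * W) ^ (wIndex A W + 1) = (W * A) ^ wIndex A W * (W * A * W) := by
    rw [mul_pow_comm_left, pow_succ]; simp only [Matrix.mul_assoc]
  have h2 : W * A * W * (A * W) ^ wIndex A W = W * (A * W) ^ (wIndex A W + 1) := by
    rw [pow_succ']; simp only [Matrix.mul_assoc]
  obtain ⟨V, hV⟩ := exists_pow_eq_mul_pow (A * W) (k := wIndex A W) (le_max_left _ _) 2
  -- VA is a left inverse of WAW on R((AW)^k).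
  have hV' : (A * W) ^ wIndex A W = V * A * (W * A * W * (A * W) ^ wIndex A W) := by
    calc (A * W) ^ wIndex A W = V * (A * W) ^ (wIndex A W + 2) := hV
      _ = _ := by rw [add_comm, pow_add, pow_two]; simp only [Matrix.mul_assoc]
  calc wCoreEP A W * W * (A * W) * (A * W) ^ wIndex A W
      = V * A * (W * A * W * (A * W) ^ wIndex A W) * Z * W * (A * W) * (A * W) ^ wIndex A W := by
        rw [← hV', ← hZ]
    _ = V * A * (W * A * W * ((A * W) ^ wIndex A W * Z)
          * (W * A * W * (A * W) ^ wIndex A W)) := by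
        simp only [Matrix.mul_assoc]
    _ = V * A * (W * A * W * (A * W) ^ wIndex A W) := by
        rw [← hZ, hC.mul_eq, h2, h1, ← Matrix.mul_assoc (orthProj _), orthProj_rangeSpace_mul]
    _ = _ := hV'.symm

/-- On the range of `(AW)^k`, the power `(A^{ⓓ,W} W)^j` is a left inverse of `(AW)^j`. -/
theorem wCoreEP_pow_cancel_left {p : Type*} [Fintype p] [DecidableEq p] (A : Matrix q n ℂ)
    (W : Matrix n q ℂ) (j : ℕ) {X : Matrix q p ℂ}
    (hX : X.rangeSpace ≤ ((A * W) ^ wIndex A W).rangeSpace) :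
    (wCoreEP A W * W) ^ j * ((A * W) ^ j * X) = X := by
  obtain ⟨Z, rfl⟩ := (rangeSpace_le_iff _ _).1 hX
  induction j with
  | zero => simp
  | succ j ih =>
    have hcomm : (A * W) ^ j * (A * W) ^ wIndex A W = (A * W) ^ wIndex A W * (A * W) ^ j := by
      rw [← pow_add, ← pow_add, add_comm]
    calc (wCoreEP A W * W) ^ (j + 1) * ((A * W) ^ (j + 1) * ((A * W) ^ wIndex A W * Z))
        = (wCoreEP A W * W) ^ j * (wCoreEP A W * W * (A * W) *
            ((A * W) ^ j * (A * W) ^ wIndex A W) * Z) := by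
          rw [pow_succ, pow_succ']; simp only [Matrix.mul_assoc]
      _ = (wCoreEP A W * W) ^ j * (wCoreEP A W * W * (A * W) * (A * W) ^ wIndex A W *
            ((A * W) ^ j * Z)) := by rw [hcomm]; simp only [Matrix.mul_assoc]
      _ = (wCoreEP A W * W) ^ j * ((A * W) ^ j * ((A * W) ^ wIndex A W * Z)) := by
          rw [wCoreEP_cancel_left, ← Matrix.mul_assoc ((A * W) ^ wIndex A W), ← hcomm,
            Matrix.mul_assoc]
      _ = _ := ih

/-- A ⋆ C ⋆ C satisfies the conditions defining C, because the projector WAWC fixes WC, whose range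
lies in R((WA)^k). -/
theorem wCoreEP_cancel_right (A : Matrix q n ℂ) (W : Matrix n q ℂ) :
    A * W * (wCoreEP A W * W * wCoreEP A W) = wCoreEP A W := by
  have hC := isWCoreEP_wCoreEP A W
  obtain ⟨Z, hZ⟩ := wCoreEP_eq_pow_mul A W
  have hr : (A * W * (wCoreEP A W * W * wCoreEP A W)).rangeSpace
      ≤ ((A * W) ^ wIndex A W).rangeSpace := by
    refine (rangeSpace_le_iff _ _).2 ⟨A * W * Z * W * wCoreEP A W, ?_⟩
    calc A * W * (wCoreEP A W * W * wCoreEP A W)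
        = A * W * ((A * W) ^ wIndex A W * Z * W * wCoreEP A W) := by rw [← hZ]
      _ = (A * W) * (A * W) ^ wIndex A W * Z * W * wCoreEP A W := by
          simp only [Matrix.mul_assoc]
      _ = _ := by rw [← pow_succ', pow_succ]; simp only [Matrix.mul_assoc]
  have hWC : W * wCoreEP A W = (W * A) ^ wIndex A W * (W * Z) := by
    rw [← Matrix.mul_assoc, ← mul_pow_comm_left, Matrix.mul_assoc, ← hZ]
  refine IsWCoreEP.unique ⟨?_, hr⟩ hC
  calc W * A * W * (A * W * (wCoreEP A W * W * wCoreEP A W))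
      = W * A * (W * A * W * wCoreEP A W * (W * wCoreEP A W)) := by
        simp only [Matrix.mul_assoc]
    _ = W * A * (W * wCoreEP A W) := by
        rw [hC.mul_eq, hWC, ← Matrix.mul_assoc (orthProj _), orthProj_rangeSpace_mul]
    _ = _ := by rw [← Matrix.mul_assoc, hC.mul_eq]

theorem wCoreEP_pow_cancel_right (A : Matrix q n ℂ) (W : Matrix n q ℂ) (j i : ℕ) :
    (A * W) ^ j * wPow (wCoreEP A W) W (j + i + 1) = wPow (wCoreEP A W) W (i + 1) :=
  pow_mul_wPow_cancel (wCoreEP_cancel_right A W) j i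

theorem rangeSpace_wPow_wCoreEP_le (A : Matrix q n ℂ) (W : Matrix n q ℂ) (j : ℕ) :
    (wPow (wCoreEP A W) W (j + 1)).rangeSpace ≤ ((A * W) ^ wIndex A W).rangeSpace := by
  refine (rangeSpace_le_iff _ _).2 ⟨wPow (wCoreEP A W) W (wIndex A W + j + 1), ?_⟩
  rw [wCoreEP_pow_cancel_right]

theorem mul_pow_mul_wPow_wCoreEP (A : Matrix q n ℂ) (W : Matrix n q ℂ) (j : ℕ) :
    W * ((A * W) ^ (j + 1) * wPow (wCoreEP A W) W (j + 1))
      = orthProj ((W * A) ^ wIndex A W).rangeSpace := by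
  have h := wCoreEP_pow_cancel_right A W j 0
  rw [← (isWCoreEP_wCoreEP A W).mul_eq, pow_succ', Matrix.mul_assoc (A * W), h]
  simp [wPow, Matrix.mul_assoc]

/-- `(A^{ⓓ,W})^{⋆(j+1)}` is the only `X` with `W(AW)^{j+1}X = P_{R((WA)^k)}` and
`R(X) ⊆ R((AW)^k)`. -/
theorem eq_wPow_wCoreEP {A X : Matrix q n ℂ} {W : Matrix n q ℂ} {j : ℕ}
    (h : W * ((A * W) ^ (j + 1) * X) = orthProj ((W * A) ^ wIndex A W).rangeSpace)
    (hr : X.rangeSpace ≤ ((A * W) ^ wIndex A W).rangeSpace) :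
    X = wPow (wCoreEP A W) W (j + 1) := by
  -- Each side is recovered by (CW)^{j+1}(AW)^{j+1}; detaching the last W of the first power exposes
  -- W(AW)^{j+1}X, which `h` prescribes.
  rw [← wCoreEP_pow_cancel_left A W (j + 1) hr,
    ← wCoreEP_pow_cancel_left A W (j + 1) (rangeSpace_wPow_wCoreEP_le A W j), pow_succ]
  simp only [Matrix.mul_assoc] at h ⊢
  rw [h, ← mul_pow_mul_wPow_wCoreEP A W j]

end Weighted

/-! ### The representations of the m-weak group inverse. -/

section Representations

variable {q n : Type*} [Fintype q] [DecidableEq q] [Fintype n] [DecidableEq n]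

/-- The Drazin inverse D satisfies A ⋆ D ⋆ D = D, which puts the range in R((AW)^k) and reduces
W(AW)^{m+1}D^{⋆(m+1)} to WAWD. This matrix fixes (WA)^k, hence the projector. -/
theorem wPow_wDrazin_mul_orthProj (A : Matrix q n ℂ) (W : Matrix n q ℂ) (m : ℕ) :
    wPow (wDrazin A W) W (m + 1) * orthProj ((W * A) ^ wIndex A W).rangeSpace
      = wPow (wCoreEP A W) W (m + 1) := by
  have hD := isWDrazin_wDrazin A W
  set D := wDrazin A W
  have hcancel : A * W * (D * W * D) = D := by
    calc A * W * (D * W * D) = A * W * D * W * D := by simp only [Matrix.mul_assoc]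
      _ = D * W * A * W * D := by rw [hD.comm]
      _ = D := hD.eq_mul.symm
  obtain ⟨Q, hQ⟩ := (rangeSpace_le_iff _ _).1
    (rangeSpace_orthProj_le ((W * A) ^ wIndex A W).rangeSpace)
  obtain ⟨Y, hY⟩ := exists_pow_eq_pow_mul (W * A) (k := wIndex A W) (le_max_right _ _) 1
  have hcomm : Commute (W * A) (W * D) := by
    calc W * A * (W * D) = W * (A * W * D) := by simp only [Matrix.mul_assoc]
      _ = W * D * (W * A) := by rw [hD.comm]; simp only [Matrix.mul_assoc]
  -- Carrying the Drazin equation from AW over to WA costs one power; `hY` recovers it in `hfix`.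
  have hpow : (W * A) ^ (wIndex A W + 1) = (W * A) ^ (wIndex A W + 1) * (W * A * (W * D)) := by
    calc (W * A) ^ (wIndex A W + 1) = W * (A * W) ^ wIndex A W * A := by
          rw [mul_pow_comm_left, pow_succ, Matrix.mul_assoc]
      _ = W * ((A * W) ^ (wIndex A W + 1) * D * W) * A := by rw [← hD.pow_eq]
      _ = W * (A * W) ^ (wIndex A W + 1) * (D * W * A) := by simp only [Matrix.mul_assoc]
      _ = _ := by rw [mul_pow_comm_left, ← hD.comm]; simp only [Matrix.mul_assoc]
  have hfix : W * A * (W * D) * (W * A) ^ wIndex A W = (W * A) ^ wIndex A W := by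
    have h2 : Commute (W * A * (W * D)) ((W * A) ^ (wIndex A W + 1)) :=
      ((Commute.refl (W * A)).mul_left hcomm.symm).pow_right _
    rw [hY, ← Matrix.mul_assoc, h2.eq, ← hpow]
  apply eq_wPow_wCoreEP
  · have h := pow_mul_wPow_cancel hcancel m 0
    simp only [add_zero, zero_add] at h
    calc W * ((A * W) ^ (m + 1) * (wPow D W (m + 1) * orthProj ((W * A) ^ wIndex A W).rangeSpace))
        = W * (A * W * ((A * W) ^ m * wPow D W (m + 1)))
            * orthProj ((W * A) ^ wIndex A W).rangeSpace := by
          rw [pow_succ']; simp only [Matrix.mul_assoc]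
      _ = W * A * (W * D) * (W * A) ^ wIndex A W * Q := by
          rw [h, hQ]; simp only [wPow, Matrix.mul_assoc]
      _ = _ := by rw [hfix, hQ]
  · refine (rangeSpace_le_iff _ _).2 ⟨wPow D W (wIndex A W + m + 1) *
      orthProj ((W * A) ^ wIndex A W).rangeSpace, ?_⟩
    rw [← Matrix.mul_assoc, pow_mul_wPow_cancel hcancel]

/-- For N = (WA)^{l+m+1}W one has W(AW)^{m+1}(AW)^l = N, so the projector condition concerns NN†,
the projector onto R(N) = R((WA)^k). -/
theorem wPowMul_mul_moorePenrose (A : Matrix q n ℂ) (W : Matrix n q ℂ) (m : ℕ) {l : ℕ}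
    (hl : wIndex A W ≤ l) :
    wPowMul A W l * (mulWPow A W (l + m + 1) * W).moorePenrose
      = wPow (wCoreEP A W) W (m + 1) := by
  rw [wPowMul_eq, mulWPow_eq]
  set N := (W * A) ^ (l + m + 1) * W with hN
  have hNr : N.rangeSpace = ((W * A) ^ wIndex A W).rangeSpace := by
    apply le_antisymm
    · rw [rangeSpace_le_iff]
      obtain ⟨d, hd⟩ := Nat.exists_eq_add_of_le (show wIndex A W ≤ l + m + 1 by omega)
      exact ⟨(W * A) ^ d * W, by rw [hN, hd, pow_add, Matrix.mul_assoc]⟩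
    -- NA = (WA)^{l+m+2}, a power beyond the index, already has range R((WA)^k).
    · rw [rangeSpace_pow_eq (W * A) (i := wIndex A W) (le_max_right _ _)
        (show (W * A).index ≤ l + m + 1 + 1 from (le_max_right _ _).trans (by
          change wIndex A W ≤ _; omega)), rangeSpace_le_iff]
      exact ⟨A, by rw [hN, pow_succ]; simp only [Matrix.mul_assoc]⟩
  apply eq_wPow_wCoreEP
  · rw [← hNr, ← mul_moorePenrose N, ← Matrix.mul_assoc ((A * W) ^ (m + 1)), ← pow_add,
      ← Matrix.mul_assoc, mul_pow_comm_left, show m + 1 + l = l + m + 1 by omega]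
  · rw [rangeSpace_pow_eq (A * W) (i := wIndex A W) (le_max_left _ _)
      (show (A * W).index ≤ l from (le_max_left _ _).trans hl), rangeSpace_le_iff]
    exact ⟨_, rfl⟩

/-- The two products are the orthogonal projectors onto R((WA)^k) and R((AW)^k). -/
theorem moorePenrose_mul_orthProj (A : Matrix q n ℂ) (W : Matrix n q ℂ) (m : ℕ) :
    (mulWPow A W (m + 1) * W * orthProj ((A * W) ^ wIndex A W).rangeSpace).moorePenrose
      = wPow (wCoreEP A W) W (m + 1) := by
  apply IsMoorePenrose.eq_moorePenrose
  rw [mulWPow_eq, ← mul_pow_comm_left]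
  set Q := orthProj ((A * W) ^ wIndex A W).rangeSpace with hQdef
  set X := wPow (wCoreEP A W) W (m + 1) with hX
  have hQr : Q.rangeSpace ≤ ((A * W) ^ wIndex A W).rangeSpace := rangeSpace_orthProj_le _
  have hQQ : Q * Q = Q := orthProj_mul_of_rangeSpace_le hQr
  have hQX : Q * X = X := orthProj_mul_of_rangeSpace_le (rangeSpace_wPow_wCoreEP_le A W m)
  have hMX : W * (A * W) ^ (m + 1) * Q * X = orthProj ((W * A) ^ wIndex A W).rangeSpace := by
    rw [Matrix.mul_assoc, hQX, Matrix.mul_assoc, hX, mul_pow_mul_wPow_wCoreEP]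
  have hXM : X * (W * (A * W) ^ (m + 1) * Q) = Q := by
    have h := wCoreEP_pow_cancel_left A W (m + 1) hQr
    rw [hX, wPow_succ]
    rw [pow_succ] at h
    simpa only [Matrix.mul_assoc] using h
  refine ⟨?_, ?_, ?_, ?_⟩
  · rw [Matrix.mul_assoc _ X, hXM, Matrix.mul_assoc _ Q, hQQ]
  · rw [hXM, hQX]
  · rw [hMX, orthProj_conjTranspose]
  · rw [hXM, orthProj_conjTranspose]

theorem wWeakGroup_eq (A : Matrix q n ℂ) (W : Matrix n q ℂ) :
    wWeakGroup A W = wCoreEP A W * W * wCoreEP A W * W * A := by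
  have hX := isWWeakGroup_wWeakGroup A W
  set X := wWeakGroup A W
  have h1 : A * W * X * W * X = X := by
    have := hX.mul_wPow
    simpa only [wPow, Matrix.mul_assoc] using this
  calc X = wCoreEP A W * W * A * W * X := by rw [← hX.mul_eq, h1]
    _ = wCoreEP A W * W * (A * W * X) := by simp only [Matrix.mul_assoc]
    _ = _ := by rw [hX.mul_eq]; simp only [Matrix.mul_assoc]

theorem mul_wPow_left (A : Matrix q n ℂ) (W : Matrix n q ℂ) (m : ℕ) :
    W * wPow A W (m + 1) = (W * A) ^ (m + 1) := by
  rw [wPow_succ, ← Matrix.mul_assoc, mul_pow_comm_left, pow_succ, Matrix.mul_assoc]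

/-- High powers of (WA)^{m+1} and of WA have the same range, and likewise for AW, so the conditions
defining the left side are those characterizing C^{⋆(m+1)}. -/
theorem wCoreEP_wPow (A : Matrix q n ℂ) (W : Matrix n q ℂ) (m : ℕ) :
    wCoreEP (wPow A W (m + 1)) W = wPow (wCoreEP A W) W (m + 1) := by
  refine (isWCoreEP_wCoreEP _ W).unique ⟨?_, ?_⟩
  · have h : (mulWPow A W (m + 1)).index ≤ wIndex (wPow A W (m + 1)) W := le_max_right _ _
    rw [mulWPow_eq] at h
    rw [mul_wPow_left, rangeSpace_pow_pow_eq (W * A) (by omega) h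
      (le_max_right (A * W).index _), ← mul_pow_comm_left, Matrix.mul_assoc]
    exact mul_pow_mul_wPow_wCoreEP A W m
  · have h : (wPow A W (m + 1) * W).index ≤ wIndex (wPow A W (m + 1)) W := le_max_left _ _
    rw [wPow_mul_right] at h
    rw [wPow_mul_right, rangeSpace_pow_pow_eq (A * W) (by omega) h
      (le_max_left _ (W * A).index)]
    exact rangeSpace_wPow_wCoreEP_le A W m

/-- The weak group inverse of A^{⋆(m+1)} begins with C^{⋆(2m+2)}, and (AW)^m strips m of its
factors. -/
theorem wmWeakGroup_eq_wPowMul_mul_wWeakGroup (A : Matrix q n ℂ) (W : Matrix n q ℂ) (m : ℕ) :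
    wmWeakGroup (m + 1) A W = wPowMul A W m * wWeakGroup (wPow A W (m + 1)) W := by
  rw [wWeakGroup_eq, wCoreEP_wPow, wmWeakGroup, mulWPow, wPowMul_eq]
  have h : wPow (wCoreEP A W) W (m + 1) * W * wPow (wCoreEP A W) W (m + 1)
      = wPow (wCoreEP A W) W (m + (m + 1) + 1) := by
    rw [wPow_mul_right, wPow_succ, wPow_succ, ← Matrix.mul_assoc, ← pow_add]
    congr 2; omega
  rw [h, ← wCoreEP_pow_cancel_right A W m (m + 1)]
  simp only [Matrix.mul_assoc]

/-- Between consecutive factors C ⋆ C WA, the inner A ⋆ C ⋆ C collapses to C, so each further factor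
contributes a single C. -/
theorem wmWeakGroup_eq_wPow_wWeakGroup_mul (A : Matrix q n ℂ) (W : Matrix n q ℂ) (m : ℕ) :
    wmWeakGroup (m + 1) A W = wPow (wWeakGroup A W) W (m + 1) * mulWPow A W m := by
  have h : ∀ j : ℕ, wPow (wWeakGroup A W) W (j + 1)
      = wPow (wCoreEP A W) W (j + 1 + 1) * (W * A) := by
    intro j
    induction j with
    | zero =>
      rw [wPow, wWeakGroup_eq]
      simp only [wPow, Matrix.mul_assoc]
    | succ j ih =>
      have hc := wCoreEP_cancel_right A W
      rw [wPow, ih, wWeakGroup_eq, wPow, wPow]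
      calc wPow (wCoreEP A W) W (j + 1) * W * wCoreEP A W * (W * A) * W
            * (wCoreEP A W * W * wCoreEP A W * W * A)
          = wPow (wCoreEP A W) W (j + 1) * W * wCoreEP A W * W
            * (A * W * (wCoreEP A W * W * wCoreEP A W)) * (W * A) := by
            simp only [Matrix.mul_assoc]
        _ = _ := by rw [hc]; rfl
  rw [h, wmWeakGroup, mulWPow_eq, mulWPow_eq, pow_succ']
  simp only [Matrix.mul_assoc]

theorem wIndex_le_one_of_comm {G H : Matrix q n ℂ} {W : Matrix n q ℂ}
    (hc : G * W * H = H * W * G) (hG : G * W * H * W * G = G) : wIndex G W ≤ 1 := by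
  have h2 : G * W * (G * W * H) = G := by
    rw [hc]; simpa only [Matrix.mul_assoc] using hG
  refine max_le (index_le_one_of_eq (Y := H * W) ?_) (index_le_one_of_eq (Y := W * H) ?_)
  · calc G * W = G * W * (G * W * H) * W := by rw [h2]
      _ = _ := by simp only [Matrix.mul_assoc]
  · calc W * G = W * (G * W * (G * W * H)) := by rw [h2]
      _ = _ := by simp only [Matrix.mul_assoc]

theorem wDrazin_eq_of_comm {G H : Matrix q n ℂ} {W : Matrix n q ℂ}
    (hc : G * W * H = H * W * G) (hG : G * W * H * W * G = G) (hH : H * W * G * W * H = H) :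
    wDrazin G W = H := by
  refine (existsUnique_isWDrazin G W).unique (isWDrazin_wDrazin G W) ⟨?_, hH.symm, hc⟩
  -- GWGWH = G needs a factor G on the left, but the exponent may be 0; `h3` works one power higher
  -- and Y brings it back down.
  obtain ⟨Y, hY⟩ := exists_pow_eq_mul_pow (G * W) (k := wIndex G W) (le_max_left _ _) 1
  have h2 : G * W * (G * W * H) = G := by
    rw [hc]; simpa only [Matrix.mul_assoc] using hG
  have h3 : (G * W) ^ (wIndex G W + 1) * (G * W * H) * W = (G * W) ^ (wIndex G W + 1) := by
    rw [pow_succ, Matrix.mul_assoc ((G * W) ^ _), h2]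
    simp only [Matrix.mul_assoc]
  calc (G * W) ^ wIndex G W = Y * ((G * W) ^ (wIndex G W + 1) * (G * W * H) * W) := by
        rw [h3, ← hY]
    _ = Y * (G * W) ^ (wIndex G W + 1) * (G * W * H) * W := by simp only [Matrix.mul_assoc]
    _ = (G * W) ^ wIndex G W * (G * W) * H * W := by
        rw [← hY]; simp only [Matrix.mul_assoc]
    _ = _ := by rw [← pow_succ]

/-- H = C^{⋆(m+2)}WA is the group inverse of G: GWH = CWA by stripping m + 1 factors C, HWG = CWA by
left cancellation on R(C), and CWAW fixes G and H because their ranges lie in R((AW)^k). -/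
theorem exists_wmWeakGroup_eq_wGroupInverse_mul (A : Matrix q n ℂ) (W : Matrix n q ℂ) (m : ℕ) :
    ∃ h : wIndex ((A * W) ^ (m + 1) * wCoreEP A W * W * A) W ≤ 1,
      wmWeakGroup (m + 1) A W =
        wGroupInverse ((A * W) ^ (m + 1) * wCoreEP A W * W * A) W h * mulWPow A W m := by
  set C := wCoreEP A W with hC
  set G := (A * W) ^ (m + 1) * C * W * A with hGdef
  set H := wPow C W (m + 1 + 1) * W * A with hHdef
  obtain ⟨Z, hZ⟩ := wCoreEP_eq_pow_mul A W
  have hGr : G.rangeSpace ≤ ((A * W) ^ wIndex A W).rangeSpace := by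
    refine (rangeSpace_le_iff _ _).2 ⟨(A * W) ^ (m + 1) * Z * W * A, ?_⟩
    rw [hGdef, hC, hZ, ← Matrix.mul_assoc, ← pow_add, add_comm, pow_add]
    simp only [Matrix.mul_assoc]
  have hHr : H.rangeSpace ≤ ((A * W) ^ wIndex A W).rangeSpace := by
    obtain ⟨Y, hY⟩ := (rangeSpace_le_iff _ _).1 (rangeSpace_wPow_wCoreEP_le A W (m + 1))
    refine (rangeSpace_le_iff _ _).2 ⟨Y * W * A, ?_⟩
    rw [hHdef, hC, hY]
    simp only [Matrix.mul_assoc]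
  have hpG : C * W * A * W * G = G := by
    simpa [Matrix.mul_assoc] using wCoreEP_pow_cancel_left A W 1 hGr
  have hpH : C * W * A * W * H = H := by
    simpa [Matrix.mul_assoc] using wCoreEP_pow_cancel_left A W 1 hHr
  have hGH : G * W * H = C * W * A := by
    calc G * W * H = (A * W) ^ (m + 1) * (C * W * A * W * H) := by
          rw [hGdef]; simp only [Matrix.mul_assoc]
      _ = (A * W) ^ (m + 1) * wPow C W (m + 1 + 0 + 1) * W * A := by
          rw [hpH, hHdef]; simp only [Matrix.mul_assoc, add_zero]
      _ = _ := by rw [hC, wCoreEP_pow_cancel_right A W (m + 1) 0]; rfl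
  have hHG : H * W * G = C * W * A := by
    have hCr : C.rangeSpace ≤ ((A * W) ^ wIndex A W).rangeSpace :=
      (isWCoreEP_wCoreEP A W).range_le
    calc H * W * G = wPow C W (m + 1 + 1) * W * ((A * W) * (A * W) ^ (m + 1) * C) * (W * A) := by
          rw [hGdef, hHdef]; simp only [Matrix.mul_assoc]
      _ = (C * W) ^ (m + 1 + 1) * ((A * W) ^ (m + 1 + 1) * C) * (W * A) := by
          rw [wPow_mul_right, pow_succ' (A * W) (m + 1)]
      _ = _ := by rw [wCoreEP_pow_cancel_left A W _ hCr, Matrix.mul_assoc]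
  have hc : G * W * H = H * W * G := hGH.trans hHG.symm
  have hG : G * W * H * W * G = G := by rw [hGH, hpG]
  have hH : H * W * G * W * H = H := by rw [hHG, hpH]
  refine ⟨wIndex_le_one_of_comm hc hG, ?_⟩
  rw [wGroupInverse, wDrazin_eq_of_comm hc hG hH, wmWeakGroup, mulWPow_eq, mulWPow_eq, pow_succ']
  simp only [hHdef, hC, Matrix.mul_assoc]

theorem wCoreEP_mul_one (A : Matrix q n ℂ) (W : Matrix n q ℂ) :
    wCoreEP (W * A) 1 = W * wCoreEP A W := by
  obtain ⟨Z, hZ⟩ := wCoreEP_eq_pow_mul A W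
  -- With weight 1 the exponent is Ind(WA), possibly less than k; the ranges of the two powers still
  -- agree.
  have hi : (W * A).index ≤ wIndex (W * A) 1 := by simp [wIndex]
  have hr : ((W * A) ^ wIndex (W * A) 1).rangeSpace = ((W * A) ^ wIndex A W).rangeSpace :=
    rangeSpace_pow_eq _ hi (le_max_right _ _)
  refine (isWCoreEP_wCoreEP _ _).unique ⟨?_, ?_⟩
  · rw [Matrix.one_mul, Matrix.mul_one, hr, ← (isWCoreEP_wCoreEP A W).mul_eq]
    simp only [Matrix.mul_assoc]
  · rw [Matrix.mul_one, hr, rangeSpace_le_iff]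
    refine ⟨W * Z, ?_⟩
    rw [hZ, ← Matrix.mul_assoc, mul_pow_comm_left, Matrix.mul_assoc]

/-- In the square of (WC)^{m+1}(WA)^m the middle part (WA)^m(WC)^{m+1} collapses to WC, and
A(WC)^{m+2} = C^{⋆(m+1)}. -/
theorem wmWeakGroup_eq_mul_mWeakGroup_sq (A : Matrix q n ℂ) (W : Matrix n q ℂ) (m : ℕ) :
    wmWeakGroup m A W = A * mWeakGroup m (W * A) ^ 2 := by
  have hm : mWeakGroup m (W * A) = (W * wCoreEP A W) ^ (m + 1) * (W * A) ^ m := by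
    rw [mWeakGroup, wmWeakGroup, wCoreEP_mul_one, mulWPow_eq, wPow_succ, Matrix.mul_one,
      Matrix.one_mul, pow_succ]
  set C := wCoreEP A W with hC
  have h1 : (W * A) ^ m * (W * C) ^ (m + 1) = W * C := by
    rw [← mul_wPow_left, ← Matrix.mul_assoc, ← mul_pow_comm_left, Matrix.mul_assoc]
    have h := wCoreEP_pow_cancel_right A W m 0
    rw [add_zero] at h
    rw [h]
    rfl
  have h2 : A * (W * C) ^ (m + 2) = wPow C W (m + 1) := by
    have h := wCoreEP_pow_cancel_right A W 1 m
    rw [← mul_wPow_left, ← Matrix.mul_assoc, ← h, pow_one, add_comm 1 m]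
  rw [hm, wmWeakGroup, mulWPow_eq, ← hC, ← h2, pow_two]
  calc A * (W * C) ^ (m + 2) * (W * A) ^ m
      = A * ((W * C) ^ (m + 1) * (W * C)) * (W * A) ^ m := by rw [← pow_succ]
    _ = A * ((W * C) ^ (m + 1) * ((W * A) ^ m * (W * C) ^ (m + 1))) * (W * A) ^ m := by rw [h1]
    _ = _ := by simp only [Matrix.mul_assoc]

end Representations

end Matrix

theorem mainTheorem3 {q n : ℕ} (A : Matrix (Fin q) (Fin n) ℂ) (W : Matrix (Fin n) (Fin q) ℂ)
    (hW : W ≠ 0) (m : ℕ) (hm : 1 ≤ m) (k : ℕ)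
    (hk : k = max (A * W).index (W * A).index) :
    A.wmWeakGroup m W =
        (A.wDrazin W).wPow W (m + 1) * Matrix.orthProj ((W * A) ^ k).rangeSpace
          * A.mulWPow W m ∧
    (∀ l : ℕ, k ≤ l →
      A.wmWeakGroup m W =
        A.wPowMul W l * (A.mulWPow W (l + m + 1) * W).moorePenrose * A.mulWPow W m) ∧
    A.wmWeakGroup m W =
        (A.mulWPow W (m + 1) * W * Matrix.orthProj ((A * W) ^ k).rangeSpace).moorePenrose
          * A.mulWPow W m ∧
    A.wmWeakGroup m W = A.wPowMul W (m - 1) * (A.wPow W m).wWeakGroup W ∧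
    A.wmWeakGroup m W = (A.wWeakGroup W).wPow W m * A.mulWPow W (m - 1) ∧
    (∃ h : ((A * W) ^ m * A.wCoreEP W * W * A).wIndex W ≤ 1,
      A.wmWeakGroup m W =
        ((A * W) ^ m * A.wCoreEP W * W * A).wGroupInverse W h * A.mulWPow W (m - 1)) ∧
    A.wmWeakGroup m W = A * (W * A).mWeakGroup m ^ 2 := by
  -- Shifting m removes the truncated subtraction in m - 1 and avoids the meaningless value of
  -- `wPow` at 0.
  obtain ⟨m, rfl⟩ := Nat.exists_eq_add_of_le' hm
  obtain rfl : k = A.wIndex W := hk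
  refine ⟨?_, fun l hl => ?_, ?_, ?_, ?_, ?_, ?_⟩
  · rw [Matrix.wPow_wDrazin_mul_orthProj, Matrix.wmWeakGroup]
  · rw [Matrix.wPowMul_mul_moorePenrose A W _ hl, Matrix.wmWeakGroup]
  · rw [Matrix.moorePenrose_mul_orthProj, Matrix.wmWeakGroup]
  · exact Matrix.wmWeakGroup_eq_wPowMul_mul_wWeakGroup A W m
  · exact Matrix.wmWeakGroup_eq_wPow_wWeakGroup_mul A W m
  · exact Matrix.exists_wmWeakGroup_eq_wGroupInverse_mul A W m
  · exact Matrix.wmWeakGroup_eq_mul_mWeakGroup_sq A W (m + 1)
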